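/- Let $\mathbb K=\mathbb R$ or $\mathbb C$, let $0<p<\infty$, and let $r\in[1,\infty]$ have conjugate exponent $r'$ (that is, $1/r+1/r'=1$). Assume that either $r=2$, or $p<r'<2$. Write $\ell_r^N$ for $\mathbb K^N$ with the $r$-norm. For Banach spaces $E_1,\dots,E_m,F$ over $\mathbb K$, a continuous $m$-linear map $T:E_1\times\dots\times E_m\to F$ is multiple $p$-summing if there is $C>0$ such that, for all finite sequences $(x^i_{j})_{j=1}^{J_i}\subset E_i$ ($1\le i\le m$), $$\Big(\sum_{j_1,\dots,j_m}\|T(x^1_{j_1},\dots,x^m_{j_m})\|_F^p\Big)^{1/p}\le C\prod_{i=1}^m w_p\big((x^i_{j})_{j}\big),\qquad w_p\big((y_j)_j\big)=\sup_{\gamma\in B_{E'}}\Big(\sum_j|\gamma(y_j)|^p\Big)^{1/p}\quad\text{for } (y_j)_j\subset E;$$ the infimum of these constants $C$ is denoted by $\pi_p(T)$. Fix $\kappa>0$. For $0<s\le2$ let $\mu_s^1$ be the $s$-stable measure on $\mathbb K$ with scale $\kappa$, i.e. the probability measure with $\int_{\mathbb K}e^{i\,\mathrm{Re}(tz)}\,d\mu_s^1(z)=e^{-\kappa|t|^s}$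 for all $t\in\mathbb K$ (a Gaussian measure if $s=2$, and the $s$-stable Lévy measure if $s<2$ and $\kappa=1$), let $\mu_s^N$ be its $N$-fold product on $\mathbb K^N$, and let $c_{s,q}=\big(\int_{\mathbb K}|z|^q\,d\mu_s^1(z)\big)^{1/q}$. Then the measure $\mu_{r'}^1$ exists, and for all $m,N$ every $m$-linear form $\phi:\ell_r^N\times\dots\times\ell_r^N\to\mathbb K$ is multiple $p$-summing, $|\phi|^p$ is integrable with respect to the $m$-fold product $\mu_{r'}^N\times\dots\times\mu_{r'}^N$, and $$\pi_p(\phi)=\frac1{c_{r',p}^{\,m}}\Big(\int_{\mathbb K^N}\!\!\cdots\int_{\mathbb K^N}|\phi(z^{(1)},\dots,z^{(m)})|^p\,d\mu_{r'}^N(z^{(1)})\cdots d\mu_{r'}^N(z^{(m)})\Big)^{1/p}.$$ -/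

import Mathlib

open MeasureTheory
open scoped ENNReal BigOperators

noncomputable section

namespace MultipleSumming

section Summing

variable {𝕜 : Type*} [RCLike 𝕜]

/-- The weak `ℓ_p`-norm `w_p((y_j)_j) = sup {(∑_j |γ(y_j)|^p)^{1/p} : γ ∈ B_{E'}}` of a finite
sequence in a normed space (the set is nonempty and bounded above for `0 < p`). -/
def weakNorm (𝕜 : Type*) [RCLike 𝕜] {E : Type*} [NormedAddCommGroup E] [NormedSpace 𝕜 E]
    (p : ℝ) {J : ℕ} (y : Fin J → E) : ℝ :=
  sSup {w : ℝ | ∃ γ : StrongDual 𝕜 E, ‖γ‖ ≤ 1 ∧ w = (∑ j, ‖γ (y j)‖ ^ p) ^ (1 / p)}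

variable {m : ℕ} {E : Fin m → Type*} [∀ i, NormedAddCommGroup (E i)] [∀ i, NormedSpace 𝕜 (E i)]
  {F : Type*} [NormedAddCommGroup F] [NormedSpace 𝕜 F]

/-- `C` is an admissible constant in the definition of a multiple `p`-summing operator:
the inequality holds for all finite sequences, of any lengths `J 0, …, J (m-1)`. -/
def IsSummingConst (p : ℝ) (T : ContinuousMultilinearMap 𝕜 E F) (C : ℝ) : Prop :=
  ∀ (J : Fin m → ℕ) (x : ∀ i, Fin (J i) → E i),
    (∑ j : (∀ i, Fin (J i)), ‖T (fun i => x i (j i))‖ ^ p) ^ (1 / p)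
      ≤ C * ∏ i, weakNorm 𝕜 p (x i)

/-- `T` is multiple `p`-summing. -/
def IsMultipleSumming (p : ℝ) (T : ContinuousMultilinearMap 𝕜 E F) : Prop :=
  ∃ C : ℝ, 0 < C ∧ IsSummingConst p T C

/-- The multiple `p`-summing norm `π_p(T)`: the infimum of all admissible constants. -/
def multipleSummingNorm (p : ℝ) (T : ContinuousMultilinearMap 𝕜 E F) : ℝ :=
  sInf {C : ℝ | 0 < C ∧ IsSummingConst p T C}

end Summing

section Stable

variable (𝕜 : Type*) [RCLike 𝕜]

/-- `μ` is the isotropic `s`-stable law on `𝕜` with scale `κ`: the probability measure with Fourier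
transform `t ↦ exp (-κ |t|^s)`, where `𝕜` is regarded as a real Euclidean space and is paired with
itself by `(t, z) ↦ Re (t z)`. For `s < 2` and `κ = 1` this is the `s`-stable Lévy measure; for
`s = 2` it is a Gaussian measure: `κ = 1/2` gives the density `(2π)^{-1/2} exp (-x^2/2)` on `ℝ`, and
`κ = 1/4` the density `π⁻¹ exp (-|z|^2)` on `ℂ`. -/
def IsStableLaw (s κ : ℝ) (μ : Measure 𝕜) : Prop :=
  IsProbabilityMeasure μ ∧
    ∀ t : 𝕜, ∫ z, Complex.exp (((RCLike.re (t * z) : ℝ) : ℂ) * Complex.I) ∂μ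
      = ((Real.exp (-(κ * ‖t‖ ^ s)) : ℝ) : ℂ)

open Classical in
/-- The `s`-stable measure `μ_s^1` on `𝕜` with scale `κ`. A finite measure is determined by its
Fourier transform, so there is at most one candidate; the value `0` is used if there is none. -/
def stableLaw (s κ : ℝ) : Measure 𝕜 :=
  if h : ∃ μ : Measure 𝕜, IsStableLaw 𝕜 s κ μ then h.choose else 0

/-- The `s`-stable measure `μ_s^N` on `𝕜^N`: the `N`-fold product of `μ_s^1`. -/
def stableMeasure (s κ : ℝ) (N : ℕ) : Measure (Fin N → 𝕜) :=
  Measure.pi (fun _ : Fin N => stableLaw 𝕜 s κ)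

/-- The constant `c_{s,q} = (∫ |z|^q dμ_s^1(z))^{1/q}`. -/
def stableConst (s κ q : ℝ) : ℝ :=
  (∫ z : 𝕜, ‖z‖ ^ q ∂(stableLaw 𝕜 s κ)) ^ (1 / q)

end Stable

end MultipleSumming

end

noncomputable section

/-! By stability, the linear form `∑ aᵢ zᵢ` under `μ_{r'}^N` is distributed as `‖a‖_{r'}` times one
variable of law `μ_{r'}^1` (`IsStableLaw.map_sum`), and `‖a‖_{r'}` is its norm as a functional on
`ℓ_r^N` (`norm_dual_piLp`). Hence `∫ |γ|^p dμ = c^p ‖γ‖^p` for every functional `γ`. Together with a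
finite `p`-th moment, this identity determines all the summing norms
(`multipleSummingNorm_eq_of_lintegral_dual`).

Upper bound: `∑ |γ(x_j)|^p ≤ w_p(x)^p ‖γ‖^p = w_p(x)^p c^{-p} ∫ |γ|^p dμ`. The left side is an
integral against a push-forward of counting measure, so in a multilinear form the sums can be
exchanged for integrals against `μ` one variable at a time (`lintegral_multilinear_le`). Lower
bound: discretize `μ` and weight each value by the `p`-th root of its mass. The weak norm of this
sequence is at most nearly `c`, the summing inequality becomes a bound on a discretized integral,
and Fatou's lemma passes to the limit (`lintegral_multilinear_le_of_isSummingConst`).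

For `s < 2` the stable law is a limit of normalized sums of Gaussian vectors with Pareto-distributed
variance, and its moments of order `p < s` come from a tail bound. For `s = 2` everything is
Gaussian. -/

namespace MultipleSumming

open Filter Set ProbabilityTheory
open scoped Topology RealInnerProductSpace

/-! ### Lévy continuity, Gaussian mixtures and normalized sums -/

section Existence

variable {E : Type*} [NormedAddCommGroup E] [InnerProductSpace ℝ E] [FiniteDimensional ℝ E]
  [MeasurableSpace E] [BorelSpace E]

/-- **Lévy's continuity theorem**: a pointwise limit of characteristic functions which is continuous
at the origin is a characteristic function. -/
theorem exists_charFun_eq_of_tendsto {μ : ℕ → ProbabilityMeasure E} {f : E → ℂ}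
    (hf : ContinuousAt f 0)
    (h : ∀ t, Tendsto (fun n ↦ charFun (μ n : Measure E) t) atTop (𝓝 (f t))) :
    ∃ ν : ProbabilityMeasure E, ∀ t, charFun (ν : Measure E) t = f t := by
  have htight : IsTightMeasureSet (Set.range fun n ↦ (μ n : Measure E)) :=
    isTightMeasureSet_of_tendsto_charFun hf h
  have hcomp : IsCompact (closure (Set.range μ)) := by
    refine isCompact_closure_of_isTightMeasureSet ?_
    convert htight using 1
    ext; simp
  -- An ultrafilter finer than `atTop` replaces a convergent subsequence; the limits of
  -- characteristic functions along `atTop` persist along it.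
  obtain ⟨ν, -, hν⟩ := hcomp.ultrafilter_le_nhds ((Ultrafilter.of atTop).map μ)
    (.trans (by simp) (monotone_principal subset_closure))
  refine ⟨ν, fun t ↦ ?_⟩
  have hν' : Tendsto μ (Ultrafilter.of (atTop : Filter ℕ)) (𝓝 ν) := hν
  rw [ProbabilityMeasure.tendsto_iff_forall_integral_rclike_tendsto ℂ] at hν'
  have h1 := hν' (BoundedContinuousFunction.innerProbChar t)
  simp_rw [← charFun_eq_integral_innerProbChar] at h1
  exact tendsto_nhds_unique h1 ((h t).mono_left (Ultrafilter.of_le _))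

/-- The law of a Gaussian vector whose variance is randomized by the law `P`. -/
def gaussianMixture (E : Type*) [NormedAddCommGroup E] [InnerProductSpace ℝ E]
    [FiniteDimensional ℝ E] [MeasurableSpace E] [BorelSpace E] (P : Measure ℝ) : Measure E :=
  (P.prod (stdGaussian E)).map fun x ↦ √(2 * x.1) • x.2

instance (P : Measure ℝ) [IsProbabilityMeasure P] :
    IsProbabilityMeasure (gaussianMixture E P) :=
  Measure.isProbabilityMeasure_map (by fun_prop)

/-- Given `x`, the vector is Gaussian with covariance `2x` times the identity, so averaging yields
the Laplace transform of `P` at `‖t‖ ^ 2`. -/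
theorem charFun_gaussianMixture (P : Measure ℝ) [IsProbabilityMeasure P]
    (hP : ∀ᵐ x ∂P, 0 ≤ x) (t : E) :
    charFun (gaussianMixture E P) t = ((∫ x, Real.exp (-(x * ‖t‖ ^ 2)) ∂P : ℝ) : ℂ) := by
  rw [gaussianMixture, charFun_apply, integral_map (by fun_prop) (by fun_prop), integral_prod,
    ← integral_complex_ofReal]
  · refine integral_congr_ae (hP.mono fun x hx ↦ ?_)
    have : ∀ y : E, ⟪√(2 * x) • y, t⟫ = ⟪y, √(2 * x) • t⟫ := fun y ↦ by
      rw [real_inner_smul_left, real_inner_smul_right]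
    simp only [this]
    rw [← charFun_apply, charFun_stdGaussian, norm_smul, ← Complex.ofReal_pow, mul_pow,
      Real.norm_eq_abs, sq_abs, Real.sq_sqrt (by positivity)]
    push_cast
    congr 1
    ring
  · refine (integrable_const (1 : ℝ)).mono (by fun_prop) ?_
    simp [Complex.norm_exp_ofReal_mul_I]

/-- The law of `c` times the sum of `n` independent copies of `ν`. -/
def scaledSum (ν : Measure E) (n : ℕ) (c : ℝ) : Measure E :=
  (Measure.pi fun _ : Fin n ↦ ν).map fun x ↦ c • ∑ i, x i

instance (ν : Measure E) [IsProbabilityMeasure ν] (n : ℕ) (c : ℝ) :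
    IsProbabilityMeasure (scaledSum ν n c) :=
  Measure.isProbabilityMeasure_map (by fun_prop)

theorem charFun_scaledSum (ν : Measure E) [IsProbabilityMeasure ν] (n : ℕ) (c : ℝ) (t : E) :
    charFun (scaledSum ν n c) t = charFun ν (c • t) ^ n := by
  rw [scaledSum, charFun_apply, integral_map (by fun_prop) (by fun_prop)]
  have : ∀ x : Fin n → E, Complex.exp (⟪c • ∑ i, x i, t⟫ * Complex.I) =
      ∏ i, Complex.exp (⟪x i, c • t⟫ * Complex.I) := fun x ↦ by
    rw [← Complex.exp_sum, ← Finset.sum_mul, ← Complex.ofReal_sum, ← sum_inner,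
      real_inner_smul_left, real_inner_smul_right]
  simp_rw [this]
  rw [integral_fintype_prod_eq_prod (f := fun (_ : Fin n) x ↦ Complex.exp (⟪x, c • t⟫ * Complex.I))]
  simp [charFun_apply]

end Existence

/-! ### Laplace transform of the Pareto law near zero -/

section LaplacePareto

/-- The integrand of the Laplace exponent of the `α`-stable subordinator. -/
def laplaceIntegrand (α y : ℝ) : ℝ := (1 - Real.exp (-y)) * y ^ (-(α + 1))

theorem laplaceIntegrand_pos {α y : ℝ} (hy : 0 < y) : 0 < laplaceIntegrand α y := by
  have : Real.exp (-y) < 1 := by simpa using hy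
  have h2 := Real.rpow_pos_of_pos hy (-(α + 1))
  unfold laplaceIntegrand
  exact mul_pos (by linarith) h2

theorem measurable_laplaceIntegrand (α : ℝ) : Measurable (laplaceIntegrand α) := by
  unfold laplaceIntegrand; fun_prop

/-- Near `0`, `1 - e^{-y} ≤ y` leaves `y^{-α}`, which needs `α < 1`; at infinity `y^{-(α+1)}` needs
`α > 0`. -/
theorem integrableOn_laplaceIntegrand {α : ℝ} (h0 : 0 < α) (h1 : α < 1) :
    IntegrableOn (laplaceIntegrand α) (Ioi 0) := by
  rw [← Ioc_union_Ioi_eq_Ioi (zero_le_one' ℝ)]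
  refine IntegrableOn.union ?_ ?_
  · have : IntegrableOn (fun y : ℝ ↦ y ^ (-α)) (Ioc 0 1) :=
      (intervalIntegrable_iff_integrableOn_Ioc_of_le zero_le_one).1
        (intervalIntegral.intervalIntegrable_rpow' (by linarith))
    refine this.mono' (measurable_laplaceIntegrand α).aestronglyMeasurable ?_
    refine (ae_restrict_iff' measurableSet_Ioc).2 (ae_of_all _ fun y hy ↦ ?_)
    rw [Real.norm_of_nonneg (laplaceIntegrand_pos hy.1).le, laplaceIntegrand]
    have : y ^ (-α) = y * y ^ (-(α + 1)) := by
      rw [← Real.rpow_one_add' hy.1.le (by linarith)]; congr 1; ring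
    rw [this]
    refine mul_le_mul_of_nonneg_right ?_ (Real.rpow_nonneg hy.1.le _)
    linarith [Real.add_one_le_exp (-y)]
  · have : IntegrableOn (fun y : ℝ ↦ y ^ (-(α + 1))) (Ioi 1) :=
      integrableOn_Ioi_rpow_of_lt (by linarith) zero_lt_one
    refine this.mono' (measurable_laplaceIntegrand α).aestronglyMeasurable ?_
    refine (ae_restrict_iff' measurableSet_Ioi).2 (ae_of_all _ fun y hy ↦ ?_)
    have hy0 : (0 : ℝ) < y := zero_lt_one.trans hy
    rw [Real.norm_of_nonneg (laplaceIntegrand_pos hy0).le, laplaceIntegrand]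
    refine mul_le_of_le_one_left (Real.rpow_nonneg hy0.le _) ?_
    linarith [Real.exp_pos (-y)]

theorem integral_laplaceIntegrand_pos {α : ℝ} (h0 : 0 < α) (h1 : α < 1) :
    0 < ∫ y in Ioi 0, laplaceIntegrand α y := by
  rw [setIntegral_pos_iff_support_of_nonneg_ae]
  · have : Function.support (laplaceIntegrand α) ∩ Ioi 0 = Ioi 0 :=
      inter_eq_right.2 fun y hy ↦ (laplaceIntegrand_pos hy).ne'
    simp [this]
  · exact (ae_restrict_iff' measurableSet_Ioi).2
      (ae_of_all _ fun y hy ↦ (laplaceIntegrand_pos hy).le)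
  · exact integrableOn_laplaceIntegrand h0 h1

theorem tendsto_integral_laplaceIntegrand {α : ℝ} (h0 : 0 < α) (h1 : α < 1) {a : ℕ → ℝ}
    (ha : Tendsto a atTop (𝓝 0)) (ha0 : ∀ n, 0 ≤ a n) :
    Tendsto (fun n ↦ ∫ y in Ioi (a n), laplaceIntegrand α y) atTop
      (𝓝 (∫ y in Ioi 0, laplaceIntegrand α y)) := by
  have := (aecover_Ioi_of_Ioi (μ := volume) ha).integral_tendsto_of_countably_generated
    (integrableOn_laplaceIntegrand h0 h1)
  refine this.congr fun n ↦ ?_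
  rw [Measure.restrict_restrict measurableSet_Ioi, inter_eq_left.2 (Ioi_subset_Ioi (ha0 n))]

theorem ae_nonneg_paretoMeasure (α : ℝ) : ∀ᵐ x ∂(paretoMeasure 1 α), 0 ≤ x := by
  rw [paretoMeasure, ae_withDensity_iff (by unfold paretoPDF; fun_prop)]
  refine ae_of_all _ fun x hx ↦ ?_
  by_contra h
  exact hx (paretoPDF_of_lt (by linarith))

/-- The Laplace transform of the Pareto law near the origin. -/
theorem integral_exp_neg_mul_paretoMeasure {α u : ℝ} (h0 : 0 < α) (hu : 0 < u) :
    ∫ x, Real.exp (-(x * u)) ∂(paretoMeasure 1 α) =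
      1 - α * u ^ α * ∫ y in Ioi u, laplaceIntegrand α y := by
  have := isProbabilityMeasure_paretoMeasure zero_lt_one h0
  have hint : Integrable (fun x ↦ Real.exp (-(x * u))) (paretoMeasure 1 α) := by
    refine (integrable_const (1 : ℝ)).mono' (by fun_prop) ?_
    filter_upwards [ae_nonneg_paretoMeasure α] with x hx
    rw [Real.norm_of_nonneg (Real.exp_pos _).le, Real.exp_le_one_iff]
    nlinarith
  suffices h : ∫ x, (1 - Real.exp (-(x * u))) ∂(paretoMeasure 1 α) =
      α * u ^ α * ∫ y in Ioi u, laplaceIntegrand α y by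
    rw [integral_sub (integrable_const _) hint] at h
    simp at h
    linarith
  -- The substitution `y = u x` moves `u` from the exponential to the lower limit of integration.
  have hscale := integral_comp_mul_left_Ioi (laplaceIntegrand α) 1 hu
  rw [mul_one, smul_eq_mul] at hscale
  rw [paretoMeasure, integral_withDensity_eq_integral_toReal_smul
    (by unfold paretoPDF; fun_prop) (by simp [paretoPDF]),
    ← setIntegral_eq_integral_of_forall_compl_eq_zero (s := Ici 1), integral_Ici_eq_integral_Ioi]
  · have : ∀ x ∈ Ioi (1 : ℝ), (paretoPDF 1 α x).toReal • (1 - Real.exp (-(x * u))) =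
        (α * u ^ (α + 1)) * laplaceIntegrand α (u * x) := fun x hx ↦ by
      have hx0 : (0 : ℝ) < x := zero_lt_one.trans hx
      have hx1 : (1 : ℝ) ≤ x := le_of_lt hx
      rw [paretoPDF_of_le hx1, ENNReal.toReal_ofReal (by positivity), laplaceIntegrand,
        Real.mul_rpow hu.le hx0.le, Real.one_rpow, Real.rpow_neg hu.le, mul_comm x u, smul_eq_mul]
      have := (Real.rpow_pos_of_pos hu (α + 1)).ne'
      field_simp
    rw [setIntegral_congr_fun measurableSet_Ioi this, integral_const_mul, hscale,
      Real.rpow_add_one hu.ne']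
    field_simp
  · intro x hx
    rw [paretoPDF_of_lt (by simpa using hx)]
    simp

end LaplacePareto

/-! ### Existence of isotropic stable laws -/

section StableExistence

theorem exists_charFun_eq_exp_norm_rpow (E : Type*) [NormedAddCommGroup E] [InnerProductSpace ℝ E]
    [FiniteDimensional ℝ E] [MeasurableSpace E] [BorelSpace E] {s : ℝ} (hs0 : 0 < s) (hs2 : s < 2) :
    ∃ K : ℝ, 0 < K ∧ ∃ ν : ProbabilityMeasure E,
      ∀ t, charFun (ν : Measure E) t = ((Real.exp (-(K * ‖t‖ ^ s)) : ℝ) : ℂ) := by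
  set α := s / 2 with hα
  have h0 : 0 < α := by positivity
  have h1 : α < 1 := by linarith
  have := isProbabilityMeasure_paretoMeasure zero_lt_one h0
  set K := α * ∫ y in Ioi 0, laplaceIntegrand α y with hK
  have hKpos : 0 < K := mul_pos h0 (integral_laplaceIntegrand_pos h0 h1)
  let ν := gaussianMixture E (paretoMeasure 1 α)
  -- With this scaling `(‖c n • t‖ ^ 2) ^ α = ‖t‖ ^ s / n`, so each factor is `1 - (K ‖t‖ ^ s +
  -- o(1)) / n` and its `n`-th power tends to `exp (-K ‖t‖ ^ s)`.
  let c : ℕ → ℝ := fun n ↦ (n : ℝ) ^ (-s⁻¹)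
  refine ⟨K, hKpos, exists_charFun_eq_of_tendsto
    (μ := fun n ↦ ⟨scaledSum ν n (c n), inferInstance⟩) ?_ fun t ↦ ?_⟩
  · have : Continuous fun t : E ↦ ((Real.exp (-(K * ‖t‖ ^ s)) : ℝ) : ℂ) := by
      have : Continuous fun t : E ↦ ‖t‖ ^ s := continuous_norm.rpow_const fun _ ↦ Or.inr hs0.le
      fun_prop
    exact this.continuousAt
  simp only [ProbabilityMeasure.coe_mk, charFun_scaledSum]
  rcases eq_or_ne t 0 with rfl | ht
  · simp [Real.zero_rpow hs0.ne']
  simp only [ν, charFun_gaussianMixture _ (ae_nonneg_paretoMeasure α), ← Complex.ofReal_pow]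
  refine (Complex.continuous_ofReal.tendsto _).comp ?_
  have htpos : 0 < ‖t‖ := norm_pos_iff.2 ht
  have hc0 : Tendsto c atTop (𝓝 0) :=
    (tendsto_rpow_neg_atTop (inv_pos.2 hs0)).comp tendsto_natCast_atTop_atTop
  have hlim : Tendsto (fun n : ℕ ↦ ‖c n • t‖ ^ 2) atTop (𝓝 0) := by
    have : Tendsto (fun n : ℕ ↦ ‖c n • t‖ ^ 2) atTop (𝓝 (‖(0 : ℝ) • t‖ ^ 2)) :=
      ((hc0.smul_const t).norm).pow 2
    simpa using this
  have key := tendsto_integral_laplaceIntegrand h0 h1 hlim fun n ↦ by positivity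
  have : ∀ᶠ n : ℕ in atTop,
      (1 + -(α * ‖t‖ ^ s * ∫ y in Ioi (‖c n • t‖ ^ 2), laplaceIntegrand α y) / n) ^ n =
      (∫ x, Real.exp (-(x * ‖c n • t‖ ^ 2)) ∂(paretoMeasure 1 α)) ^ n := by
    filter_upwards [eventually_gt_atTop 0] with n hn
    have hn' : (0 : ℝ) < n := by exact_mod_cast hn
    have hcn : 0 < c n := Real.rpow_pos_of_pos hn' _
    rw [integral_exp_neg_mul_paretoMeasure h0 (by rw [norm_smul, Real.norm_of_nonneg hcn.le]; positivity)]
    have : (‖c n • t‖ ^ 2) ^ α = ‖t‖ ^ s / n := by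
      rw [← Real.rpow_natCast_mul (norm_nonneg _), show ((2 : ℕ) : ℝ) * α = s by rw [hα]; push_cast; ring,
        norm_smul, Real.mul_rpow (norm_nonneg _) (norm_nonneg _), Real.norm_of_nonneg hcn.le,
        ← Real.rpow_mul hn'.le, neg_mul, inv_mul_cancel₀ hs0.ne', Real.rpow_neg_one]
      field_simp
    rw [this]
    congr 1
    ring
  refine Tendsto.congr' this (Real.tendsto_one_add_pow_exp_of_tendsto ?_)
  have hfin : Tendsto (fun n : ℕ ↦ -(α * ‖t‖ ^ s * ∫ y in Ioi (‖c n • t‖ ^ 2), laplaceIntegrand α y))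
      atTop (𝓝 (-(K * ‖t‖ ^ s))) := by
    rw [show K * ‖t‖ ^ s = α * ‖t‖ ^ s * ∫ y in Ioi 0, laplaceIntegrand α y by rw [hK]; ring]
    exact (key.const_mul _).neg
  refine hfin.congr' ?_
  filter_upwards [eventually_gt_atTop 0] with n hn
  have hn' : (n : ℝ) ≠ 0 := by exact_mod_cast hn.ne'
  field_simp

/-- Existence of the isotropic stable laws of any index `s ∈ (0, 2]` and any scale. -/
theorem exists_charFun_eq_exp_neg (E : Type*) [NormedAddCommGroup E] [InnerProductSpace ℝ E]
    [FiniteDimensional ℝ E] [MeasurableSpace E] [BorelSpace E] {s κ : ℝ} (hs0 : 0 < s) (hs2 : s ≤ 2)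
    (hκ : 0 < κ) : ∃ ν : Measure E, IsProbabilityMeasure ν ∧ (s = 2 → IsGaussian ν) ∧
      ∀ t, charFun ν t = ((Real.exp (-(κ * ‖t‖ ^ s)) : ℝ) : ℂ) := by
  rcases hs2.lt_or_eq with hs2 | rfl
  · obtain ⟨K, hK, ν, hν⟩ := exists_charFun_eq_exp_norm_rpow E hs0 hs2
    refine ⟨(ν : Measure E).map ((κ / K) ^ s⁻¹ • ·), Measure.isProbabilityMeasure_map (by fun_prop),
      fun h ↦ absurd h hs2.ne, fun t ↦ ?_⟩
    -- Dilating by `(κ / K) ^ s⁻¹` turns the scale `K` into the prescribed `κ`.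
    have hc : 0 < κ / K := by positivity
    rw [charFun_map_smul, hν, norm_smul, Real.mul_rpow (norm_nonneg _) (norm_nonneg _),
      Real.norm_of_nonneg (by positivity), ← Real.rpow_mul hc.le, inv_mul_cancel₀ hs0.ne',
      Real.rpow_one]
    rw [← mul_assoc, mul_div_cancel₀ _ hK.ne']
  · refine ⟨(stdGaussian E).map (√(2 * κ) • ·), Measure.isProbabilityMeasure_map (by fun_prop),
      fun _ ↦ ?_, fun t ↦ ?_⟩
    · exact isGaussian_map (μ := stdGaussian E) (√(2 * κ) • ContinuousLinearMap.id ℝ E)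
    · rw [charFun_map_smul, charFun_stdGaussian, norm_smul, Real.norm_of_nonneg (by positivity),
        ← Complex.ofReal_pow, mul_pow, Real.sq_sqrt (by positivity)]
      norm_num
      congr 1
      ring

end StableExistence

/-! ### Moments from tail bounds -/

section Tail

/-- Layer-cake formula: on `(0, 1]` the tail is at most `1`, and beyond `1` the integrand is at most
`K t^{p-1-s}`, integrable because `p < s`. -/
theorem integrable_rpow_of_measureReal_le {Ω : Type*} [MeasurableSpace Ω] {μ : Measure Ω}
    [IsProbabilityMeasure μ] {f : Ω → ℝ} (hf : Measurable f) (hf0 : ∀ x, 0 ≤ f x) {p s K : ℝ}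
    (hp : 0 < p) (hps : p < s) (hK : ∀ r, 0 < r → μ.real {x | r < f x} ≤ K * r ^ (-s)) :
    Integrable (fun x ↦ f x ^ p) μ := by
  refine ⟨(hf.pow_const p).aestronglyMeasurable, ?_⟩
  have hK0 : 0 ≤ K := by simpa using measureReal_nonneg.trans (hK 1 one_pos)
  rw [hasFiniteIntegral_iff_ofReal (ae_of_all _ fun x ↦ Real.rpow_nonneg (hf0 x) p),
    lintegral_rpow_eq_lintegral_meas_lt_mul μ (ae_of_all _ hf0) hf.aemeasurable hp,
    ← Ioc_union_Ioi_eq_Ioi (zero_le_one' ℝ),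
    lintegral_union measurableSet_Ioi (Ioc_disjoint_Ioi le_rfl)]
  refine ENNReal.mul_lt_top ENNReal.ofReal_lt_top (ENNReal.add_lt_top.2 ⟨?_, ?_⟩)
  · have hint : IntegrableOn (fun t : ℝ ↦ t ^ (p - 1)) (Ioc 0 1) :=
      (intervalIntegrable_iff_integrableOn_Ioc_of_le zero_le_one).1
        (intervalIntegral.intervalIntegrable_rpow' (by linarith))
    refine lt_of_le_of_lt (setLIntegral_mono' measurableSet_Ioc fun t _ ↦
      mul_le_of_le_one_left' prob_le_one) hint.lintegral_lt_top
  · have hint : IntegrableOn (fun t : ℝ ↦ K * t ^ (-s + (p - 1))) (Ioi 1) :=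
      (integrableOn_Ioi_rpow_of_lt (by linarith) zero_lt_one).const_mul K
    refine lt_of_le_of_lt (setLIntegral_mono' measurableSet_Ioi fun t ht ↦ ?_)
      hint.lintegral_lt_top
    have ht0 : (0 : ℝ) < t := zero_lt_one.trans ht
    rw [Real.rpow_add ht0, ← mul_assoc, ENNReal.ofReal_mul (by positivity)]
    gcongr
    rw [← ofReal_measureReal]
    exact ENNReal.ofReal_le_ofReal (hK t ht0)

end Tail

/-! ### Uniqueness, moments and stability of the stable law -/

section StableLaw

variable {𝕜 : Type*} [RCLike 𝕜]

theorem real_inner_eq_re_mul (w z : 𝕜) : ⟪w, z⟫ = RCLike.re (z * star w) := rfl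

/-- The inner product conjugates one factor and the pairing `Re (t z)` does not; `star t` reconciles
them, harmlessly for stable laws since `‖star t‖ = ‖t‖`. -/
theorem integral_exp_re_mul_eq_charFun (μ : Measure 𝕜) (t : 𝕜) :
    ∫ z, Complex.exp (((RCLike.re (t * z) : ℝ) : ℂ) * Complex.I) ∂μ = charFun μ (star t) := by
  rw [charFun_apply]
  refine integral_congr_ae (ae_of_all _ fun z ↦ ?_)
  simp only
  rw [real_inner_comm, real_inner_eq_re_mul, star_star, mul_comm t z]

theorem isStableLaw_iff_charFun {s κ : ℝ} {μ : Measure 𝕜} :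
    IsStableLaw 𝕜 s κ μ ↔ IsProbabilityMeasure μ ∧
      ∀ t, charFun μ t = ((Real.exp (-(κ * ‖t‖ ^ s)) : ℝ) : ℂ) := by
  unfold IsStableLaw
  simp_rw [integral_exp_re_mul_eq_charFun]
  refine and_congr_right fun _ ↦ ⟨fun h t ↦ ?_, fun h t ↦ ?_⟩
  · simpa using h (star t)
  · simpa using h (star t)

theorem eq_of_integral_exp_re_mul {μ ν : Measure 𝕜} [IsFiniteMeasure μ] [IsFiniteMeasure ν]
    (h : ∀ t : 𝕜, ∫ z, Complex.exp (((RCLike.re (t * z) : ℝ) : ℂ) * Complex.I) ∂μ =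
      ∫ z, Complex.exp (((RCLike.re (t * z) : ℝ) : ℂ) * Complex.I) ∂ν) : μ = ν := by
  refine Measure.ext_of_charFun (funext fun t ↦ ?_)
  have := h (star t)
  rwa [integral_exp_re_mul_eq_charFun, integral_exp_re_mul_eq_charFun, star_star] at this

theorem IsStableLaw.unique {s κ : ℝ} {μ ν : Measure 𝕜} (hμ : IsStableLaw 𝕜 s κ μ)
    (hν : IsStableLaw 𝕜 s κ ν) : μ = ν := by
  have := hμ.1
  have := hν.1
  exact eq_of_integral_exp_re_mul fun t ↦ (hμ.2 t).trans (hν.2 t).symm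

variable (𝕜) in
theorem isStableLaw_stableLaw {s κ : ℝ} (hs0 : 0 < s) (hs2 : s ≤ 2) (hκ : 0 < κ) :
    IsStableLaw 𝕜 s κ (stableLaw 𝕜 s κ) := by
  have h : ∃ μ : Measure 𝕜, IsStableLaw 𝕜 s κ μ := by
    obtain ⟨ν, hν, -, h⟩ := exists_charFun_eq_exp_neg 𝕜 hs0 hs2 hκ
    exact ⟨ν, isStableLaw_iff_charFun.2 ⟨hν, h⟩⟩
  rw [stableLaw, dif_pos h]
  exact h.choose_spec

variable (𝕜) in
theorem isGaussian_stableLaw {κ : ℝ} (hκ : 0 < κ) : IsGaussian (stableLaw 𝕜 2 κ) := by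
  obtain ⟨ν, hν, hG, h⟩ := exists_charFun_eq_exp_neg 𝕜 two_pos le_rfl hκ
  rw [(isStableLaw_stableLaw 𝕜 two_pos le_rfl hκ).unique (isStableLaw_iff_charFun.2 ⟨hν, h⟩)]
  exact hG rfl

/-- The tail is controlled by the integral of `1 - charFun` over `|t| ≤ 2 / r`, where `1 - e^{-u} ≤
u` gives the order `r^{-s}`. -/
theorem IsStableLaw.measureReal_inner_le {s κ : ℝ} {μ : Measure 𝕜} (hμ : IsStableLaw 𝕜 s κ μ)
    (hs0 : 0 < s) (hκ : 0 < κ) {a : 𝕜} (ha : ‖a‖ ≤ 1) {r : ℝ} (hr : 0 < r) :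
    μ.real {z | r < |⟪a, z⟫|} ≤ 2 * κ * 2 ^ s * r ^ (-s) := by
  obtain ⟨hprob, hchar⟩ := isStableLaw_iff_charFun.1 hμ
  refine (measureReal_abs_inner_gt_le_integral_charFun hr).trans ?_
  have hbound : ∀ t ∈ uIoc (-2 * r⁻¹) (2 * r⁻¹),
      ‖1 - charFun μ (t • a)‖ ≤ κ * (2 * r⁻¹) ^ s := fun t ht ↦ by
    have ht' : |t| ≤ 2 * r⁻¹ := by
      rw [uIoc_of_le (by rw [neg_mul, neg_le_self_iff]; positivity)] at ht
      exact abs_le.2 ⟨by linarith [ht.1], ht.2⟩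
    have h1 : ‖t • a‖ ≤ 2 * r⁻¹ := by
      rw [norm_smul, Real.norm_eq_abs]
      exact (mul_le_of_le_one_right (abs_nonneg t) ha).trans ht'
    rw [hchar, ← Complex.ofReal_one, ← Complex.ofReal_sub, Complex.norm_real, Real.norm_of_nonneg]
    · calc 1 - Real.exp (-(κ * ‖t • a‖ ^ s)) ≤ κ * ‖t • a‖ ^ s := by
            linarith [Real.add_one_le_exp (-(κ * ‖t • a‖ ^ s))]
        _ ≤ κ * (2 * r⁻¹) ^ s := by gcongr
    · rw [sub_nonneg, Real.exp_le_one_iff]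
      have : 0 ≤ κ * ‖t • a‖ ^ s := by positivity
      linarith
  have := intervalIntegral.norm_integral_le_of_norm_le_const hbound
  refine (mul_le_mul_of_nonneg_left this (by positivity)).trans (le_of_eq ?_)
  rw [show 2 * r⁻¹ - -2 * r⁻¹ = 4 * r⁻¹ by ring, abs_of_pos (by positivity),
    Real.mul_rpow two_pos.le (by positivity), Real.inv_rpow hr.le, Real.rpow_neg hr.le]
  field_simp
  ring

theorem IsStableLaw.integrable_norm_rpow {s κ p : ℝ} {μ : Measure 𝕜} (hμ : IsStableLaw 𝕜 s κ μ)
    (hs0 : 0 < s) (hκ : 0 < κ) (hp : 0 < p) (hps : p < s) :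
    Integrable (fun z ↦ ‖z‖ ^ p) μ := by
  have := hμ.1
  refine integrable_rpow_of_measureReal_le measurable_norm (fun _ ↦ norm_nonneg _) hp hps
    (K := 2 * (2 * κ * 2 ^ s * 2 ^ s)) fun r hr ↦ ?_
  -- `RCLike.I` is `0` over `ℝ`, so only an inequality holds uniformly in `𝕜`.
  have hI : ‖(RCLike.I : 𝕜)‖ ≤ 1 := by
    rcases eq_or_ne (RCLike.I : 𝕜) 0 with h | h
    · simp [h]
    · exact (RCLike.norm_I_of_ne_zero h).le
  have hsub : {z : 𝕜 | r < ‖z‖} ⊆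
      {z | r / 2 < |⟪(1 : 𝕜), z⟫|} ∪ {z | r / 2 < |⟪(RCLike.I : 𝕜), z⟫|} := fun z hz ↦ by
    have h1 : ⟪(1 : 𝕜), z⟫ = RCLike.re z := by simp [real_inner_eq_re_mul]
    have h2 : ⟪(RCLike.I : 𝕜), z⟫ = RCLike.im z := by
      simp [real_inner_eq_re_mul]
    have h3 : ‖z‖ ≤ |RCLike.re z| + |RCLike.im z| := by
      conv_lhs => rw [← RCLike.re_add_im z]
      refine (norm_add_le _ _).trans ?_
      rw [norm_mul, RCLike.norm_ofReal, RCLike.norm_ofReal]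
      exact add_le_add le_rfl (mul_le_of_le_one_right (abs_nonneg _) hI)
    simp only [mem_union, mem_ofPred_eq, h1, h2] at hz ⊢
    by_contra! h
    linarith
  have hhalf : (r / 2) ^ (-s) = 2 ^ s * r ^ (-s) := by
    rw [Real.div_rpow hr.le two_pos.le, Real.rpow_neg two_pos.le, div_inv_eq_mul, mul_comm]
  have t1 := hμ.measureReal_inner_le hs0 hκ (a := 1) (by simp) (half_pos hr)
  have t2 := hμ.measureReal_inner_le hs0 hκ hI (half_pos hr)
  rw [hhalf] at t1 t2
  calc μ.real {z : 𝕜 | r < ‖z‖} ≤ _ := measureReal_mono hsub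
    _ ≤ _ := measureReal_union_le _ _
    _ ≤ _ := add_le_add t1 t2
    _ = _ := by ring

variable (𝕜) in
theorem integrable_norm_rpow_stableLaw {s κ p : ℝ} (hs0 : 0 < s) (hs2 : s ≤ 2) (hκ : 0 < κ)
    (hp : 0 < p) (hps : s = 2 ∨ p < s) : Integrable (fun z ↦ ‖z‖ ^ p) (stableLaw 𝕜 s κ) := by
  rcases hps with rfl | hps
  · have := isGaussian_stableLaw 𝕜 hκ
    have h := (IsGaussian.memLp_id (stableLaw 𝕜 2 κ) (ENNReal.ofReal p)
      ENNReal.ofReal_ne_top).integrable_norm_rpow (by simpa using hp) ENNReal.ofReal_ne_top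
    simpa [ENNReal.toReal_ofReal hp.le] using h
  · exact (isStableLaw_stableLaw 𝕜 hs0 hs2 hκ).integrable_norm_rpow hs0 hκ hp hps

/-- A vanishing moment would concentrate `μ` at `0`, making its Fourier transform `1` everywhere,
against `exp (-κ) < 1` at `t = 1`. -/
theorem IsStableLaw.integral_norm_rpow_pos {s κ p : ℝ} {μ : Measure 𝕜} (hμ : IsStableLaw 𝕜 s κ μ)
    (hκ : 0 < κ) (hp : 0 < p) (hint : Integrable (fun z ↦ ‖z‖ ^ p) μ) :
    0 < ∫ z, ‖z‖ ^ p ∂μ := by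
  have := hμ.1
  refine (integral_nonneg fun z ↦ by positivity).lt_of_ne' fun h ↦ ?_
  rw [integral_eq_zero_iff_of_nonneg (fun z ↦ by positivity) hint] at h
  have h1 := hμ.2 1
  have h2 : ∫ z, Complex.exp (((RCLike.re ((1 : 𝕜) * z) : ℝ) : ℂ) * Complex.I) ∂μ = 1 := by
    rw [integral_congr_ae (g := fun _ ↦ (1 : ℂ))]
    · simp
    · filter_upwards [h] with z hz
      have : z = 0 := by
        simpa [Real.rpow_eq_zero (norm_nonneg z) hp.ne'] using hz
      simp [this]
  rw [h2] at h1
  have h3 : Real.exp (-(κ * ‖(1 : 𝕜)‖ ^ s)) = 1 := by exact_mod_cast h1.symm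
  rw [norm_one, Real.one_rpow, Real.exp_eq_one_iff] at h3
  linarith

/-- The stability property: linear combinations of independent variables of law `μ` have again the
law of a multiple of such a variable. -/
theorem IsStableLaw.map_sum {s κ : ℝ} {μ : Measure 𝕜} (hμ : IsStableLaw 𝕜 s κ μ) (hs0 : 0 < s)
    {ι : Type*} [Fintype ι] (a : ι → 𝕜) :
    (Measure.pi fun _ : ι ↦ μ).map (fun z ↦ ∑ i, a i * z i) =
      μ.map (fun z ↦ (((∑ i, ‖a i‖ ^ s) ^ s⁻¹ : ℝ) : 𝕜) * z) := by
  have := hμ.1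
  refine eq_of_integral_exp_re_mul fun t ↦ ?_
  have hcont : Continuous fun z : 𝕜 ↦
      Complex.exp (((RCLike.re (t * z) : ℝ) : ℂ) * Complex.I) := by fun_prop
  have hsum : Continuous fun z : ι → 𝕜 ↦ ∑ i, a i * z i := by fun_prop
  rw [integral_map hsum.measurable.aemeasurable hcont.aestronglyMeasurable,
    integral_map (by fun_prop) hcont.aestronglyMeasurable]
  have h1 : ∀ z : ι → 𝕜, Complex.exp (((RCLike.re (t * ∑ i, a i * z i) : ℝ) : ℂ) * Complex.I) =
      ∏ i, Complex.exp (((RCLike.re (t * a i * z i) : ℝ) : ℂ) * Complex.I) := fun z ↦ by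
    rw [← Complex.exp_sum, ← Finset.sum_mul, ← Complex.ofReal_sum, ← _root_.map_sum, Finset.mul_sum]
    simp_rw [mul_assoc]
  simp_rw [h1, ← mul_assoc]
  rw [integral_fintype_prod_eq_prod
    (f := fun i z ↦ Complex.exp (((RCLike.re (t * a i * z) : ℝ) : ℂ) * Complex.I)), hμ.2]
  simp_rw [hμ.2]
  rw [← Complex.ofReal_prod, ← Real.exp_sum, Finset.sum_neg_distrib, ← Finset.mul_sum]
  have hA : 0 ≤ ∑ i, ‖a i‖ ^ s := by positivity
  rw [norm_mul t, RCLike.norm_ofReal, abs_of_nonneg (by positivity),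
    Real.mul_rpow (norm_nonneg _) (by positivity), ← Real.rpow_mul hA, inv_mul_cancel₀ hs0.ne',
    Real.rpow_one]
  simp_rw [norm_mul, Real.mul_rpow (norm_nonneg _) (norm_nonneg _), ← Finset.mul_sum]

theorem lintegral_sum_stableMeasure {s κ p : ℝ} (hs0 : 0 < s) (hs2 : s ≤ 2) (hκ : 0 < κ)
    {N : ℕ} (a : Fin N → 𝕜) :
    ∫⁻ z, ‖∑ i, a i * z i‖ₑ ^ p ∂(stableMeasure 𝕜 s κ N) =
      ∫⁻ z, ‖(((∑ i, ‖a i‖ ^ s) ^ s⁻¹ : ℝ) : 𝕜) * z‖ₑ ^ p ∂(stableLaw 𝕜 s κ) := by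
  have h := (isStableLaw_stableLaw 𝕜 hs0 hs2 hκ).map_sum hs0 a
  have hsum : Continuous fun z : Fin N → 𝕜 ↦ ∑ i, a i * z i := by fun_prop
  rw [← lintegral_map (f := fun z : 𝕜 ↦ ‖z‖ₑ ^ p) (g := fun z : Fin N → 𝕜 ↦ ∑ i, a i * z i)
    (by fun_prop) hsum.measurable, stableMeasure, h, lintegral_map (by fun_prop) (by fun_prop)]

end StableLaw

/-! ### Weak norms and the summing inequality in `ℝ≥0∞` -/

section WeakNorm

variable {𝕜 : Type*} [RCLike 𝕜]

theorem enorm_rpow_eq_ofReal {F : Type*} [SeminormedAddCommGroup F] {p : ℝ} (hp : 0 ≤ p) (x : F) :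
    ‖x‖ₑ ^ p = ENNReal.ofReal (‖x‖ ^ p) := by
  rw [← ofReal_norm, ENNReal.ofReal_rpow_of_nonneg (norm_nonneg _) hp]

theorem sum_enorm_rpow_eq_ofReal {ι F : Type*} [Fintype ι] [SeminormedAddCommGroup F] {p : ℝ}
    (hp : 0 ≤ p) (x : ι → F) : ∑ i, ‖x i‖ₑ ^ p = ENNReal.ofReal (∑ i, ‖x i‖ ^ p) := by
  rw [ENNReal.ofReal_sum_of_nonneg fun _ _ ↦ by positivity]
  simp_rw [enorm_rpow_eq_ofReal hp]

theorem enorm_prod_eq {ι : Type*} [Fintype ι] (a : ι → 𝕜) : ‖∏ i, a i‖ₑ = ∏ i, ‖a i‖ₑ := by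
  simp_rw [← ofReal_norm]
  rw [norm_prod, ENNReal.ofReal_prod_of_nonneg fun _ _ ↦ norm_nonneg _]

variable {E : Type*} [NormedAddCommGroup E] [NormedSpace 𝕜 E]

theorem weakNorm_nonneg (p : ℝ) {J : ℕ} (y : Fin J → E) : 0 ≤ weakNorm 𝕜 p y := by
  refine Real.sSup_nonneg ?_
  rintro w ⟨γ, -, rfl⟩
  positivity

theorem bddAbove_weakNorm {p : ℝ} (hp : 0 < p) {J : ℕ} (y : Fin J → E) :
    BddAbove {w : ℝ | ∃ γ : StrongDual 𝕜 E, ‖γ‖ ≤ 1 ∧ w = (∑ j, ‖γ (y j)‖ ^ p) ^ (1 / p)} := by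
  refine ⟨(∑ j, ‖y j‖ ^ p) ^ (1 / p), ?_⟩
  rintro w ⟨γ, hγ, rfl⟩
  gcongr with j
  exact γ.le_of_opNorm_le hγ (y j) |>.trans_eq (one_mul _)

theorem sum_enorm_rpow_le_weakNorm {p : ℝ} (hp : 0 < p) {J : ℕ} (y : Fin J → E)
    (γ : StrongDual 𝕜 E) :
    ∑ j, ‖γ (y j)‖ₑ ^ p ≤ ENNReal.ofReal (weakNorm 𝕜 p y) ^ p * ‖γ‖ₑ ^ p := by
  rcases eq_or_ne γ 0 with rfl | hγ
  · simp [hp]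
  have hγ0 : 0 < ‖γ‖ := norm_pos_iff.2 hγ
  have hw := weakNorm_nonneg (𝕜 := 𝕜) p y
  have h1 : (∑ j, ‖(((‖γ‖⁻¹ : ℝ) : 𝕜) • γ) (y j)‖ ^ p) ^ (1 / p) ≤ weakNorm 𝕜 p y := by
    refine le_csSup (bddAbove_weakNorm hp y) ⟨_, ?_, rfl⟩
    rw [norm_smul, RCLike.norm_ofReal, abs_of_pos (inv_pos.2 hγ0), inv_mul_cancel₀ hγ0.ne']
  rw [one_div, Real.rpow_inv_le_iff_of_pos (by positivity) hw hp] at h1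
  have h2 : ∑ j, ‖γ (y j)‖ ^ p ≤ weakNorm 𝕜 p y ^ p * ‖γ‖ ^ p := by
    refine le_trans (le_of_eq ?_) (mul_le_mul_of_nonneg_right h1 (by positivity))
    rw [Finset.sum_mul]
    refine Finset.sum_congr rfl fun j _ ↦ ?_
    rw [_root_.smul_apply, norm_smul, RCLike.norm_ofReal,
      abs_of_pos (inv_pos.2 hγ0), ← Real.mul_rpow (by positivity) (by positivity)]
    congr 1
    field_simp
  rw [sum_enorm_rpow_eq_ofReal hp.le, enorm_rpow_eq_ofReal hp.le,
    ENNReal.ofReal_rpow_of_nonneg hw hp.le, ← ENNReal.ofReal_mul (by positivity)]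
  exact ENNReal.ofReal_le_ofReal h2

theorem ofReal_weakNorm_rpow_le {p : ℝ} (hp : 0 < p) {J : ℕ} (y : Fin J → E) {B : ℝ≥0∞}
    (hB : ∀ γ : StrongDual 𝕜 E, ‖γ‖ ≤ 1 → ∑ j, ‖γ (y j)‖ₑ ^ p ≤ B) :
    ENNReal.ofReal (weakNorm 𝕜 p y) ^ p ≤ B := by
  rcases eq_or_ne B ⊤ with rfl | hBt
  · exact le_top
  rw [← ENNReal.le_rpow_inv_iff hp]
  refine ENNReal.ofReal_le_of_le_toReal (csSup_le ⟨_, 0, by simp, rfl⟩ ?_)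
  rintro w ⟨γ, hγ, rfl⟩
  have := hB γ hγ
  rw [sum_enorm_rpow_eq_ofReal hp.le, ENNReal.ofReal_le_iff_le_toReal hBt] at this
  rw [← ENNReal.toReal_rpow, one_div]
  exact Real.rpow_le_rpow (by positivity) this (by positivity)

/-- Taking `p`-th powers in `ℝ≥0∞` lets sums be compared with `lintegral`s without integrability
conditions. -/
theorem isSummingConst_iff {p : ℝ} (hp : 0 < p) {m : ℕ} {E : Fin m → Type*}
    [∀ i, NormedAddCommGroup (E i)] [∀ i, NormedSpace 𝕜 (E i)] {F : Type*} [NormedAddCommGroup F]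
    [NormedSpace 𝕜 F] (T : ContinuousMultilinearMap 𝕜 E F) {C : ℝ} (hC : 0 ≤ C) :
    IsSummingConst p T C ↔ ∀ (J : Fin m → ℕ) (x : ∀ i, Fin (J i) → E i),
      ∑ j : (∀ i, Fin (J i)), ‖T (fun i => x i (j i))‖ₑ ^ p
        ≤ ENNReal.ofReal C ^ p * ∏ i, ENNReal.ofReal (weakNorm 𝕜 p (x i)) ^ p := by
  refine forall₂_congr fun J x ↦ ?_
  have hw : 0 ≤ ∏ i, weakNorm 𝕜 p (x i) := Finset.prod_nonneg fun i _ ↦ weakNorm_nonneg p _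
  rw [one_div, Real.rpow_inv_le_iff_of_pos (by positivity) (by positivity) hp,
    ENNReal.prod_rpow_of_nonneg hp.le,
    ← ENNReal.ofReal_prod_of_nonneg fun i _ ↦ weakNorm_nonneg p _,
    ← ENNReal.mul_rpow_of_nonneg _ _ hp.le, ← ENNReal.ofReal_mul hC,
    ENNReal.ofReal_rpow_of_nonneg (by positivity) hp.le, sum_enorm_rpow_eq_ofReal hp.le,
    ENNReal.ofReal_le_ofReal_iff (by positivity)]

end WeakNorm

/-! ### Domination of multilinear forms, one variable at a time -/

section Domination

variable {𝕜 : Type*} [RCLike 𝕜]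

theorem lintegral_pi_succ {E : Type*} [MeasurableSpace E] {m : ℕ} (ν : Fin (m + 1) → Measure E) [∀ i, SigmaFinite (ν i)]
    {f : (Fin (m + 1) → E) → ℝ≥0∞} (hf : Measurable f) :
    ∫⁻ z, f z ∂(Measure.pi ν) =
      ∫⁻ a, ∫⁻ w, f (Fin.cons a w) ∂(Measure.pi fun i : Fin m ↦ ν i.succ) ∂(ν 0) := by
  have h := (measurePreserving_piFinSuccAbove ν 0).symm
  rw [← h.lintegral_comp_emb (MeasurableEquiv.measurableEmbedding _), lintegral_prod]
  · simp [MeasurableEquiv.piFinSuccAbove_symm_apply, Fin.insertNthEquiv]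
  · exact (hf.comp (MeasurableEquiv.measurable _)).aemeasurable

/-- Used both for counting measures carried by finite sequences and for laws of simple functions; `x
i` need not be injective. -/
theorem lintegral_pi_map_fintype {E : Type*} [MeasurableSpace E] {m : ℕ} {J : Fin m → ℕ} (ρ : ∀ i, Measure (Fin (J i)))
    [∀ i, IsFiniteMeasure (ρ i)] (x : ∀ i, Fin (J i) → E) {f : (Fin m → E) → ℝ≥0∞}
    (hf : Measurable f) :
    ∫⁻ z, f z ∂(Measure.pi fun i ↦ (ρ i).map (x i)) =
      ∑ j : (∀ i, Fin (J i)), f (fun i ↦ x i (j i)) * ∏ i, ρ i {j i} := by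
  rw [← Measure.pi_map_pi fun i ↦ (measurable_of_finite (x i)).aemeasurable,
    lintegral_map hf (by fun_prop), lintegral_fintype]
  simp_rw [Measure.pi_singleton]

variable {E : Type*} [NormedAddCommGroup E] [NormedSpace 𝕜 E]
  [MeasurableSpace E] [BorelSpace E] [SecondCountableTopology E]

theorem measurable_enorm_rpow_multilinear {m : ℕ}
    (φ : ContinuousMultilinearMap 𝕜 (fun _ : Fin m ↦ E) 𝕜) (p : ℝ) :
    Measurable fun z : Fin m → E ↦ ‖φ z‖ₑ ^ p :=
  (φ.cont.measurable.enorm).pow_const p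

/-- If linear forms are dominated in the `p`-th mean, variable by variable, then so are
multilinear forms. -/
theorem lintegral_multilinear_le {p : ℝ} {m : ℕ} (ν μ : Fin m → Measure E)
    [∀ i, SigmaFinite (ν i)] [∀ i, SigmaFinite (μ i)] (K : Fin m → ℝ≥0∞)
    (h : ∀ i (γ : StrongDual 𝕜 E), ∫⁻ z, ‖γ z‖ₑ ^ p ∂(ν i) ≤ K i * ∫⁻ z, ‖γ z‖ₑ ^ p ∂(μ i))
    (φ : ContinuousMultilinearMap 𝕜 (fun _ : Fin m ↦ E) 𝕜) :
    ∫⁻ z, ‖φ z‖ₑ ^ p ∂(Measure.pi ν) ≤ (∏ i, K i) * ∫⁻ z, ‖φ z‖ₑ ^ p ∂(Measure.pi μ) := by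
  induction m with
  | zero => simp
  | succ m ih =>
    have hφ := measurable_enorm_rpow_multilinear φ p
    have hcons : Measurable fun q : E × (Fin m → E) ↦
        ‖φ (Fin.cons q.1 q.2 : Fin (m + 1) → E)‖ₑ ^ p := by
      refine hφ.comp (measurable_pi_lambda _ fun i ↦ ?_)
      refine Fin.cases ?_ (fun i ↦ ?_) i
      · simpa using measurable_fst
      · simp only [Fin.cons_succ]
        fun_prop
    rw [lintegral_pi_succ ν hφ, lintegral_pi_succ μ hφ, Fin.prod_univ_succ]
    -- The induction hypothesis handles the last `m` variables with `a` frozen; after Tonelli, `w`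
    -- is frozen and the first slot is a linear form.
    calc ∫⁻ a, ∫⁻ w, ‖φ (Fin.cons a w)‖ₑ ^ p ∂(Measure.pi fun i : Fin m ↦ ν i.succ) ∂(ν 0)
        ≤ ∫⁻ a, (∏ i : Fin m, K i.succ) *
            ∫⁻ w, ‖φ (Fin.cons a w)‖ₑ ^ p ∂(Measure.pi fun i : Fin m ↦ μ i.succ) ∂(ν 0) := by
          refine lintegral_mono fun a ↦ ?_
          simpa using ih (fun i ↦ ν i.succ) (fun i ↦ μ i.succ) (fun i ↦ K i.succ)
            (fun i ↦ h i.succ) (φ.curryLeft a)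
      _ = (∏ i : Fin m, K i.succ) * ∫⁻ w, ∫⁻ a, ‖φ (Fin.cons a w)‖ₑ ^ p ∂(ν 0)
            ∂(Measure.pi fun i : Fin m ↦ μ i.succ) := by
          rw [lintegral_const_mul _ hcons.lintegral_prod_right',
            lintegral_lintegral_swap hcons.aemeasurable]
      _ ≤ (∏ i : Fin m, K i.succ) * ∫⁻ w, K 0 * ∫⁻ a, ‖φ (Fin.cons a w)‖ₑ ^ p ∂(μ 0)
            ∂(Measure.pi fun i : Fin m ↦ μ i.succ) := by
          gcongr with w
          have := h 0 (φ.toContinuousLinearMap (Fin.cons 0 w) 0)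
          simpa [ContinuousMultilinearMap.toContinuousLinearMap, Fin.update_cons_zero] using this
      _ = K 0 * (∏ i : Fin m, K i.succ) * ∫⁻ a, ∫⁻ w, ‖φ (Fin.cons a w)‖ₑ ^ p
            ∂(Measure.pi fun i : Fin m ↦ μ i.succ) ∂(μ 0) := by
          rw [lintegral_const_mul _ hcons.lintegral_prod_left',
            ← lintegral_lintegral_swap hcons.aemeasurable]
          ring

end Domination

/-! ### Summing norms as moments, for a measure with `∫ |γ|^p = c ‖γ‖^p` -/

section Abstract

variable {𝕜 : Type*} [RCLike 𝕜] {E : Type*} [NormedAddCommGroup E] [NormedSpace 𝕜 E]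
  [MeasurableSpace E] [BorelSpace E] [SecondCountableTopology E]

theorem sum_multilinear_le_of_lintegral_dual {p : ℝ} (hp : 0 < p) {μ : Measure E} [SigmaFinite μ]
    {c : ℝ≥0∞} (hc0 : c ≠ 0) (hct : c ≠ ⊤)
    (hμ : ∀ γ : StrongDual 𝕜 E, ∫⁻ z, ‖γ z‖ₑ ^ p ∂μ = c * ‖γ‖ₑ ^ p) {m : ℕ}
    (φ : ContinuousMultilinearMap 𝕜 (fun _ : Fin m ↦ E) 𝕜) (J : Fin m → ℕ)
    (x : ∀ i, Fin (J i) → E) :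
    ∑ j : (∀ i, Fin (J i)), ‖φ (fun i ↦ x i (j i))‖ₑ ^ p ≤
      c⁻¹ ^ m * (∫⁻ z, ‖φ z‖ₑ ^ p ∂(Measure.pi fun _ : Fin m ↦ μ)) *
        ∏ i, ENNReal.ofReal (weakNorm 𝕜 p (x i)) ^ p := by
  have h := lintegral_multilinear_le (p := p) (fun i ↦ (Measure.count : Measure (Fin (J i))).map (x i))
    (fun _ ↦ μ) (fun i ↦ c⁻¹ * ENNReal.ofReal (weakNorm 𝕜 p (x i)) ^ p) (fun i γ ↦ ?_) φ
  · rw [lintegral_pi_map_fintype _ _ (measurable_enorm_rpow_multilinear φ p)] at h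
    simp only [Measure.count_singleton, Finset.prod_const_one, mul_one, Finset.prod_mul_distrib,
      Finset.prod_const, Finset.card_univ, Fintype.card_fin] at h
    refine h.trans (le_of_eq ?_)
    ring
  · rw [lintegral_map (by fun_prop) (measurable_of_finite _), lintegral_fintype, hμ]
    simp only [Measure.count_singleton, mul_one]
    refine (sum_enorm_rpow_le_weakNorm hp (x i) γ).trans (le_of_eq ?_)
    rw [mul_assoc, mul_left_comm, ← mul_assoc c⁻¹, ENNReal.inv_mul_cancel hc0 hct, one_mul]

theorem lintegral_multilinear_simpleFunc_le {p : ℝ} (hp : 0 < p) {μ : Measure E}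
    [IsProbabilityMeasure μ] {m : ℕ} (φ : ContinuousMultilinearMap 𝕜 (fun _ : Fin m ↦ E) 𝕜)
    {C : ℝ} (hC : 0 ≤ C) (hφ : IsSummingConst p φ C) (f : SimpleFunc E E) {B : ℝ≥0∞}
    (hB : ∀ γ : StrongDual 𝕜 E, ‖γ‖ ≤ 1 → ∫⁻ z, ‖γ (f z)‖ₑ ^ p ∂μ ≤ B) :
    ∫⁻ z, ‖φ (fun i ↦ f (z i))‖ₑ ^ p ∂(Measure.pi fun _ : Fin m ↦ μ) ≤
      ENNReal.ofReal C ^ p * B ^ m := by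
  let e := f.range.equivFin
  let k := f.range.card
  let g : E → Fin k := fun z ↦ e ⟨f z, f.mem_range_self z⟩
  let x : Fin k → E := fun j ↦ (e.symm j : E)
  have hxg : x ∘ g = f := by ext z; simp [x, g]
  have hg : Measurable g := by
    refine measurable_to_countable' fun j ↦ ?_
    have : g ⁻¹' {j} = f ⁻¹' {x j} := by
      ext z
      simp only [g, x, mem_preimage, mem_singleton_iff]
      rw [← e.eq_symm_apply, Subtype.ext_iff]
    rw [this]
    exact f.measurableSet_fiber _
  let ρ := μ.map g
  have : IsProbabilityMeasure ρ := Measure.isProbabilityMeasure_map hg.aemeasurable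
  have hρ : ρ.map x = μ.map f := by
    rw [Measure.map_map (measurable_of_finite x) hg, hxg]
  have hρt : ∀ j, ρ {j} ≠ ⊤ := fun j ↦ measure_ne_top _ _
  -- The weight `ρ {j} ^ (1/p)` makes `∑ |γ (y j)|^p` equal to `∫ |γ ∘ f|^p dμ`; by homogeneity in
  -- each slot the same weights recover the product masses.
  let y : Fin k → E := fun j ↦ (((ρ {j}).toReal ^ p⁻¹ : ℝ) : 𝕜) • x j
  have hscal : ∀ j, ‖(((ρ {j}).toReal ^ p⁻¹ : ℝ) : 𝕜)‖ₑ ^ p = ρ {j} := fun j ↦ by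
    rw [enorm_rpow_eq_ofReal hp.le, RCLike.norm_ofReal, abs_of_nonneg (by positivity),
      ← Real.rpow_mul (by positivity), inv_mul_cancel₀ hp.ne', Real.rpow_one,
      ENNReal.ofReal_toReal (hρt j)]
  have hy : ENNReal.ofReal (weakNorm 𝕜 p y) ^ p ≤ B := by
    refine ofReal_weakNorm_rpow_le hp y fun γ hγ ↦ (le_of_eq ?_).trans (hB γ hγ)
    rw [← lintegral_map (f := fun z ↦ ‖γ z‖ₑ ^ p) (by fun_prop) f.measurable, ← hρ,
      lintegral_map (by fun_prop) (measurable_of_finite x), lintegral_fintype]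
    refine Finset.sum_congr rfl fun j _ ↦ ?_
    rw [map_smul, enorm_smul, ENNReal.mul_rpow_of_nonneg _ _ hp.le, hscal, mul_comm]
  calc ∫⁻ z, ‖φ (fun i ↦ f (z i))‖ₑ ^ p ∂(Measure.pi fun _ : Fin m ↦ μ)
      = ∫⁻ z, ‖φ z‖ₑ ^ p ∂(Measure.pi fun _ : Fin m ↦ ρ.map x) := by
        rw [hρ, ← Measure.pi_map_pi fun _ ↦ f.measurable.aemeasurable,
          lintegral_map (measurable_enorm_rpow_multilinear φ p) (by fun_prop)]
    _ = ∑ j : Fin m → Fin k, ‖φ (fun i ↦ y (j i))‖ₑ ^ p := by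
        rw [lintegral_pi_map_fintype (J := fun _ ↦ k) (fun _ ↦ ρ) (fun _ ↦ x)
          (measurable_enorm_rpow_multilinear φ p)]
        refine Finset.sum_congr rfl fun j _ ↦ ?_
        simp only [y]
        rw [φ.map_smul_univ, enorm_smul, ENNReal.mul_rpow_of_nonneg _ _ hp.le, enorm_prod_eq,
          ← ENNReal.prod_rpow_of_nonneg hp.le, mul_comm]
        simp_rw [hscal]
    _ ≤ ENNReal.ofReal C ^ p * ∏ _i : Fin m, ENNReal.ofReal (weakNorm 𝕜 p y) ^ p :=
        (isSummingConst_iff hp φ hC).1 hφ (fun _ ↦ k) fun _ ↦ y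
    _ ≤ ENNReal.ofReal C ^ p * B ^ m := by
        rw [Finset.prod_const, Finset.card_univ, Fintype.card_fin]
        gcongr

/-- Replaces Minkowski's inequality, so that `p < 1` is allowed: either `b ≤ ε a` or `a ≤ ε⁻¹ b`.
The factor of `a ^ p` tends to `1` as `ε → 0`. -/
theorem add_rpow_le_of_pos {p ε : ℝ} (hp : 0 < p) (hε : 0 < ε) (a b : ℝ≥0∞) :
    (a + b) ^ p ≤ ENNReal.ofReal (1 + ε) ^ p * a ^ p + ENNReal.ofReal (1 + ε⁻¹) ^ p * b ^ p := by
  rw [← ENNReal.mul_rpow_of_nonneg _ _ hp.le, ← ENNReal.mul_rpow_of_nonneg _ _ hp.le,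
    ENNReal.ofReal_add zero_le_one hε.le, ENNReal.ofReal_add zero_le_one (inv_pos.2 hε).le,
    ENNReal.ofReal_one, add_mul, add_mul, one_mul, one_mul]
  rcases le_total b (ENNReal.ofReal ε * a) with h | h
  · exact le_add_right (ENNReal.rpow_le_rpow (by gcongr) hp.le)
  · refine le_add_left (ENNReal.rpow_le_rpow ?_ hp.le)
    rw [add_comm]
    gcongr
    rw [ENNReal.ofReal_inv_of_pos hε]
    calc a = (ENNReal.ofReal ε)⁻¹ * (ENNReal.ofReal ε * a) := by
          rw [← mul_assoc, ENNReal.inv_mul_cancel (by simpa using hε) (by simp), one_mul]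
      _ ≤ _ := by gcongr

theorem lintegral_multilinear_le_of_isSummingConst {p : ℝ} (hp : 0 < p) {μ : Measure E}
    [IsProbabilityMeasure μ] {c : ℝ≥0∞} (hct : c ≠ ⊤)
    (hμ : ∀ γ : StrongDual 𝕜 E, ∫⁻ z, ‖γ z‖ₑ ^ p ∂μ = c * ‖γ‖ₑ ^ p)
    (hmom : ∫⁻ z, ‖z‖ₑ ^ p ∂μ ≠ ⊤) {m : ℕ}
    (φ : ContinuousMultilinearMap 𝕜 (fun _ : Fin m ↦ E) 𝕜)
    {C : ℝ} (hC : 0 ≤ C) (hφ : IsSummingConst p φ C) :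
    ∫⁻ z, ‖φ z‖ₑ ^ p ∂(Measure.pi fun _ : Fin m ↦ μ) ≤ ENNReal.ofReal C ^ p * c ^ m := by
  let f : ℕ → SimpleFunc E E := SimpleFunc.approxOn id measurable_id univ 0 (mem_univ 0)
  have hf : ∀ z, Tendsto (fun n ↦ f n z) atTop (𝓝 z) := fun z ↦
    SimpleFunc.tendsto_approxOn measurable_id (mem_univ 0) (by simp)
  have hmeas : ∀ n, Measurable fun z ↦ ‖f n z - z‖ₑ ^ p := fun n ↦
    (((f n).measurable.sub measurable_id).enorm).pow_const p
  let δ : ℕ → ℝ≥0∞ := fun n ↦ ∫⁻ z, ‖f n z - z‖ₑ ^ p ∂μ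
  have hδ : Tendsto δ atTop (𝓝 0) := by
    have h0 : ∫⁻ _ : E, 0 ∂μ = 0 := lintegral_zero
    rw [← h0]
    refine tendsto_lintegral_of_dominated_convergence (fun z ↦ ‖z‖ₑ ^ p) (fun n ↦ ?_)
      (fun n ↦ ae_of_all _ fun z ↦ ?_) hmom (ae_of_all _ fun z ↦ ?_)
    · exact hmeas n
    -- Since the approximation has base point `0`, its error never exceeds `‖z‖`, whose `p`-th power
    -- is integrable.
    · refine ENNReal.rpow_le_rpow ?_ hp.le
      have := SimpleFunc.nnnorm_approxOn_le (f := id) measurable_id (s := univ) (y₀ := (0 : E))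
        trivial z n
      simp only [id, sub_zero] at this
      exact ENNReal.coe_le_coe.2 this
    · have h1 : Tendsto (fun n ↦ ‖f n z - z‖ₑ) atTop (𝓝 ‖z - z‖ₑ) :=
        ((hf z).sub tendsto_const_nhds).enorm
      have h2 := (ENNReal.continuous_rpow_const (y := p)).tendsto _ |>.comp h1
      simpa [Function.comp_def, hp] using h2
  have hstep : ∀ ε : ℝ, 0 < ε → ∫⁻ z, ‖φ z‖ₑ ^ p ∂(Measure.pi fun _ : Fin m ↦ μ) ≤
      ENNReal.ofReal C ^ p * (ENNReal.ofReal (1 + ε) ^ p * c) ^ m := fun ε hε ↦ by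
    let B : ℕ → ℝ≥0∞ := fun n ↦
      ENNReal.ofReal (1 + ε) ^ p * c + ENNReal.ofReal (1 + ε⁻¹) ^ p * δ n
    have hB : ∀ n (γ : StrongDual 𝕜 E), ‖γ‖ ≤ 1 → ∫⁻ z, ‖γ (f n z)‖ₑ ^ p ∂μ ≤ B n := by
      intro n γ hγ
      have hγ' : ‖γ‖ₑ ≤ 1 := by
        rw [← ofReal_norm]; exact ENNReal.ofReal_le_one.2 hγ
      calc ∫⁻ z, ‖γ (f n z)‖ₑ ^ p ∂μ
          ≤ ∫⁻ z, (ENNReal.ofReal (1 + ε) ^ p * ‖γ z‖ₑ ^ p +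
              ENNReal.ofReal (1 + ε⁻¹) ^ p * ‖f n z - z‖ₑ ^ p) ∂μ := by
            refine lintegral_mono fun z ↦ ?_
            refine le_trans (ENNReal.rpow_le_rpow ?_ hp.le) (add_rpow_le_of_pos hp hε _ _)
            have h1 : γ (f n z) = γ z + γ (f n z - z) := by rw [← map_add]; congr 1; abel
            rw [h1]
            refine (enorm_add_le _ _).trans (add_le_add le_rfl ?_)
            refine (γ.le_opENorm _).trans ?_
            exact mul_le_of_le_one_left' hγ'
        _ = ENNReal.ofReal (1 + ε) ^ p * (c * ‖γ‖ₑ ^ p) + ENNReal.ofReal (1 + ε⁻¹) ^ p * δ n := by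
            rw [lintegral_add_left (by fun_prop), lintegral_const_mul _ (by fun_prop),
              lintegral_const_mul _ (hmeas n), hμ]
        _ ≤ B n := by
            refine add_le_add_left (mul_le_mul_right ?_ _) _
            exact mul_le_of_le_one_right' (ENNReal.rpow_le_one hγ' hp.le)
    have hBlim : Tendsto (fun n ↦ ENNReal.ofReal C ^ p * B n ^ m) atTop
        (𝓝 (ENNReal.ofReal C ^ p * (ENNReal.ofReal (1 + ε) ^ p * c) ^ m)) := by
      have hfin : ∀ a : ℝ, ENNReal.ofReal a ^ p ≠ ⊤ := fun a ↦
        ENNReal.rpow_ne_top_of_nonneg hp.le ENNReal.ofReal_ne_top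
      refine ENNReal.Tendsto.const_mul ?_ (Or.inr (hfin _))
      refine ENNReal.Tendsto.pow ?_
      have := (ENNReal.Tendsto.const_mul hδ (Or.inr (hfin (1 + ε⁻¹)))).const_add
        (ENNReal.ofReal (1 + ε) ^ p * c)
      simpa using this
    calc ∫⁻ z, ‖φ z‖ₑ ^ p ∂(Measure.pi fun _ : Fin m ↦ μ)
        = ∫⁻ z, liminf (fun n ↦ ‖φ (fun i ↦ f n (z i))‖ₑ ^ p) atTop
            ∂(Measure.pi fun _ : Fin m ↦ μ) := by
          refine lintegral_congr fun z ↦ (Tendsto.liminf_eq ?_).symm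
          have h1 : Tendsto (fun n i ↦ f n (z i)) atTop (𝓝 z) :=
            tendsto_pi_nhds.2 fun i ↦ hf (z i)
          have h2 := ((φ.cont.tendsto z).comp h1).enorm
          exact (ENNReal.continuous_rpow_const.tendsto _).comp h2
      _ ≤ liminf (fun n ↦ ∫⁻ z, ‖φ (fun i ↦ f n (z i))‖ₑ ^ p ∂(Measure.pi fun _ : Fin m ↦ μ))
            atTop := by
          refine lintegral_liminf_le fun n ↦ (measurable_enorm_rpow_multilinear φ p).comp ?_
          exact measurable_pi_lambda _ fun i ↦ (f n).measurable.comp (measurable_pi_apply i)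
      _ ≤ liminf (fun n ↦ ENNReal.ofReal C ^ p * B n ^ m) atTop :=
          liminf_le_liminf (Eventually.of_forall fun n ↦
            lintegral_multilinear_simpleFunc_le hp φ hC hφ (f n) (hB n))
      _ = _ := hBlim.liminf_eq
  have hlim : Tendsto (fun ε : ℝ ↦ ENNReal.ofReal C ^ p * (ENNReal.ofReal (1 + ε) ^ p * c) ^ m)
      (𝓝[>] 0) (𝓝 (ENNReal.ofReal C ^ p * c ^ m)) := by
    refine ENNReal.Tendsto.const_mul ?_
      (Or.inr (ENNReal.rpow_ne_top_of_nonneg hp.le ENNReal.ofReal_ne_top))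
    refine ENNReal.Tendsto.pow ?_
    have h1 : Tendsto (fun ε : ℝ ↦ ENNReal.ofReal (1 + ε) ^ p) (𝓝[>] 0)
        (𝓝 (ENNReal.ofReal (1 + 0) ^ p)) := by
      refine Tendsto.mono_left ?_ nhdsWithin_le_nhds
      have : Continuous fun ε : ℝ ↦ ENNReal.ofReal (1 + ε) ^ p :=
        ENNReal.continuous_rpow_const.comp (ENNReal.continuous_ofReal.comp (by fun_prop))
      exact this.tendsto 0
    simpa using ENNReal.Tendsto.mul_const h1 (Or.inr hct)
  exact ge_of_tendsto hlim (eventually_mem_nhdsWithin.mono fun ε hε ↦ hstep ε hε)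

/-- If the `p`-th moments of linear forms under `μ` are proportional to the `p`-th powers of their
norms, then multiple `p`-summing norms of multilinear forms are `p`-th moments. -/
theorem multipleSummingNorm_eq_of_lintegral_dual {p : ℝ} (hp : 0 < p) {μ : Measure E}
    [IsProbabilityMeasure μ] {c : ℝ} (hc : 0 < c)
    (hμ : ∀ γ : StrongDual 𝕜 E, ∫⁻ z, ‖γ z‖ₑ ^ p ∂μ = ENNReal.ofReal c * ‖γ‖ₑ ^ p)
    (hmom : Integrable (fun z ↦ ‖z‖ ^ p) μ) {m : ℕ}
    (φ : ContinuousMultilinearMap 𝕜 (fun _ : Fin m ↦ E) 𝕜) :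
    IsMultipleSumming p φ ∧
    Integrable (fun z : Fin m → E ↦ ‖φ z‖ ^ p) (Measure.pi fun _ : Fin m ↦ μ) ∧
    multipleSummingNorm p φ = 1 / (c ^ (1 / p)) ^ m *
      (∫ z, ‖φ z‖ ^ p ∂(Measure.pi fun _ : Fin m ↦ μ)) ^ (1 / p) := by
  have hint : Integrable (fun z : Fin m → E ↦ ‖φ z‖ ^ p) (Measure.pi fun _ : Fin m ↦ μ) := by
    have h1 : Integrable (fun z : Fin m → E ↦ ‖φ‖ ^ p * ∏ i, ‖z i‖ ^ p)
        (Measure.pi fun _ : Fin m ↦ μ) :=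
      (Integrable.fintype_prod (f := fun (_ : Fin m) (z : E) ↦ ‖z‖ ^ p) fun _ ↦ hmom).const_mul _
    refine h1.mono' ?_ (ae_of_all _ fun z ↦ ?_)
    · exact ((φ.cont.measurable.norm).pow_const p).aestronglyMeasurable
    · rw [Real.norm_of_nonneg (by positivity),
        Real.finsetProd_rpow _ _ (fun _ _ ↦ norm_nonneg _),
        ← Real.mul_rpow (norm_nonneg _) (by positivity)]
      exact Real.rpow_le_rpow (norm_nonneg _) (φ.le_opNorm z) hp.le
  have hmom' : ∫⁻ z, ‖z‖ₑ ^ p ∂μ ≠ ⊤ := by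
    simp_rw [enorm_rpow_eq_ofReal hp.le]
    exact ((hasFiniteIntegral_iff_ofReal (ae_of_all _ fun z ↦ by positivity)).1 hmom.2).ne
  set I := ∫ z, ‖φ z‖ ^ p ∂(Measure.pi fun _ : Fin m ↦ μ) with hI
  have hI0 : 0 ≤ I := integral_nonneg fun z ↦ by positivity
  have hIl : ∫⁻ z, ‖φ z‖ₑ ^ p ∂(Measure.pi fun _ : Fin m ↦ μ) = ENNReal.ofReal I := by
    simp_rw [enorm_rpow_eq_ofReal hp.le]
    rw [hI, ofReal_integral_eq_lintegral_ofReal hint (ae_of_all _ fun z ↦ by positivity)]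
  set R := 1 / (c ^ (1 / p)) ^ m * I ^ (1 / p) with hR
  have hR0 : 0 ≤ R := by positivity
  have hRp : R ^ p = (c ^ m)⁻¹ * I := by
    rw [hR, Real.mul_rpow (by positivity) (by positivity), ← Real.rpow_mul hI0, one_div_mul_cancel hp.ne',
      Real.rpow_one, one_div, Real.inv_rpow (by positivity), ← Real.rpow_natCast, ← Real.rpow_natCast,
      ← Real.rpow_mul hc.le, ← Real.rpow_mul hc.le]
    congr 3
    field_simp
  have hup : ∀ C, R ≤ C → IsSummingConst p φ C := fun C hC ↦ by
    rw [isSummingConst_iff hp φ (hR0.trans hC)]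
    intro J x
    refine (sum_multilinear_le_of_lintegral_dual hp (by simpa using hc) ENNReal.ofReal_ne_top hμ φ J
      x).trans ?_
    gcongr
    rw [hIl, ← ENNReal.ofReal_inv_of_pos hc, ← ENNReal.ofReal_pow (by positivity),
      ← ENNReal.ofReal_mul (by positivity), inv_pow, ← hRp,
      ENNReal.ofReal_rpow_of_nonneg (hR0.trans hC) hp.le]
    exact ENNReal.ofReal_le_ofReal (Real.rpow_le_rpow hR0 hC hp.le)
  -- Admissible constants must be positive, whereas `R` may be `0`, so the infimum need not be
  -- attained.
  refine ⟨⟨R + 1, by positivity, hup _ (by linarith)⟩, hint, ?_⟩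
  refine csInf_eq_of_forall_ge_of_forall_gt_exists_lt ⟨R + 1, by positivity, hup _ (by linarith)⟩ ?_ ?_
  · rintro C ⟨hC0, hC⟩
    have := lintegral_multilinear_le_of_isSummingConst hp ENNReal.ofReal_ne_top hμ hmom' φ hC0.le hC
    rw [hIl, ENNReal.ofReal_rpow_of_nonneg hC0.le hp.le, ← ENNReal.ofReal_pow hc.le,
      ← ENNReal.ofReal_mul (by positivity), ENNReal.ofReal_le_ofReal_iff (by positivity)] at this
    rw [← Real.rpow_le_rpow_iff hR0 hC0.le hp, hRp, inv_mul_le_iff₀ (by positivity), mul_comm]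
    exact this
  · intro w hw
    exact ⟨(R + w) / 2, ⟨by linarith, hup _ (by linarith)⟩, by linarith⟩

end Abstract

/-! ### The dual norm of `ℓ_r^N` -/

section Duality

variable {𝕜 : Type*} [RCLike 𝕜] {N : ℕ} {r r' : ℝ≥0∞}

theorem dual_piLp_apply [Fact (1 ≤ r)] (γ : StrongDual 𝕜 (PiLp r fun _ : Fin N ↦ 𝕜)) (z : Fin N → 𝕜) :
    γ (WithLp.toLp r z) = ∑ i, γ (WithLp.toLp r (Pi.single i 1)) * z i := by
  have : WithLp.toLp r z = ∑ i, z i • WithLp.toLp r (Pi.single i (1 : 𝕜)) := by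
    ext j
    simp [Pi.single_apply]
  rw [this, map_sum]
  simp [mul_comm]

theorem holderConjugate_cases (h : ENNReal.HolderConjugate r r') (hr' : r' ≠ ⊤) :
    (r = ⊤ ∧ r'.toReal = 1) ∨ (r ≠ ⊤ ∧ r.toReal.HolderConjugate r'.toReal) := by
  rcases eq_or_ne r ⊤ with rfl | hr
  · exact Or.inl ⟨rfl, by simp [(ENNReal.HolderConjugate.eq_top_iff_eq_one ⊤ r').1 rfl]⟩
  · have := ENNReal.HolderTriple.toReal (p := r) (q := r') 1
      (ENNReal.toReal_pos (ENNReal.HolderConjugate.ne_zero r r') hr)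
      (ENNReal.toReal_pos (ENNReal.HolderConjugate.ne_zero r' r) hr')
    exact Or.inr ⟨hr, by simpa using this⟩

theorem norm_dual_piLp [Fact (1 ≤ r)] (h : ENNReal.HolderConjugate r r') (hr' : r' ≠ ⊤)
    (γ : StrongDual 𝕜 (PiLp r fun _ : Fin N ↦ 𝕜)) :
    ‖γ‖ = (∑ i, ‖γ (WithLp.toLp r (Pi.single i 1))‖ ^ r'.toReal) ^ (r'.toReal)⁻¹ := by
  have hcases := holderConjugate_cases h hr'
  set s := r'.toReal with hs
  have hs1 : 1 ≤ s := by
    rcases hcases with ⟨-, h⟩ | ⟨-, h⟩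
    · exact h.ge
    · exact h.symm.lt.le
  have hs0 : 0 < s := by linarith
  set a : Fin N → 𝕜 := fun i ↦ γ (WithLp.toLp r (Pi.single i 1)) with ha
  set S := ∑ i, ‖a i‖ ^ s with hS
  have hS0 : 0 ≤ S := by positivity
  have hγ : ∀ x : PiLp r (fun _ : Fin N ↦ 𝕜), γ x = ∑ i, a i * x i := fun x ↦
    dual_piLp_apply γ (WithLp.ofLp x)
  refine le_antisymm (γ.opNorm_le_bound (by positivity) fun x ↦ ?_) ?_
  · rw [hγ]
    refine (norm_sum_le _ _).trans ?_
    simp_rw [norm_mul]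
    rcases hcases with ⟨rfl, h1⟩ | ⟨hr, hc⟩
    · rw [hS, h1]
      simp only [Real.rpow_one, inv_one]
      rw [Finset.sum_mul]
      gcongr with i
      exact PiLp.norm_apply_le x i
    · rw [PiLp.norm_eq_sum (ENNReal.toReal_pos (zero_lt_one.trans_le Fact.out).ne' hr), ← one_div]
      have := Real.inner_le_Lp_mul_Lq Finset.univ (fun i ↦ ‖a i‖) (fun i ↦ ‖x i‖) hc.symm
      simpa using this
  -- The extremal vector for Hölder's inequality: `a i * x i = |a i|^s` and, when `a i ≠ 0`, `‖x i‖
  -- = |a i|^(s-1)`. At `a i = 0` with `s = 1` the latter is only `0 ≤ 0^0 = 1`.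
  · let x : PiLp r (fun _ : Fin N ↦ 𝕜) :=
      WithLp.toLp r fun i ↦ star (a i) * ((‖a i‖ ^ (s - 2) : ℝ) : 𝕜)
    have hxi : ∀ i, ‖x i‖ ≤ ‖a i‖ ^ (s - 1) := fun i ↦ by
      simp only [x, norm_mul, norm_star, RCLike.norm_ofReal]
      rw [abs_of_nonneg (by positivity)]
      rcases eq_or_ne (a i) 0 with h0 | h0
      · rw [h0, norm_zero, zero_mul]
        positivity
      · rw [show s - 1 = 1 + (s - 2) by ring, Real.rpow_add (norm_pos_iff.2 h0), Real.rpow_one]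
    have hmul : ∀ i, a i * x i = ((‖a i‖ ^ s : ℝ) : 𝕜) := fun i ↦ by
      simp only [x]
      rcases eq_or_ne (a i) 0 with h0 | h0
      · simp [h0, Real.zero_rpow hs0.ne']
      · rw [← mul_assoc, RCLike.star_def, RCLike.mul_conj, ← RCLike.ofReal_pow, ← RCLike.ofReal_mul,
          ← Real.rpow_natCast, ← Real.rpow_add (norm_pos_iff.2 h0)]
        congr 2
        push_cast
        ring
    have hx : ‖x‖ ≤ S ^ (1 - s⁻¹) := by
      rcases hcases with ⟨rfl, h1⟩ | ⟨hr, hc⟩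
      · rw [h1, inv_one, sub_self, Real.rpow_zero, PiLp.norm_eq_ciSup]
        refine Real.iSup_le (fun i ↦ (hxi i).trans ?_) zero_le_one
        rw [h1, sub_self, Real.rpow_zero]
      · have hr0 : 0 < r.toReal := hc.pos
        rw [PiLp.norm_eq_sum hr0, hc.symm.one_sub_inv, one_div]
        refine Real.rpow_le_rpow (by positivity) (Finset.sum_le_sum fun i _ ↦ ?_) (by positivity)
        refine (Real.rpow_le_rpow (norm_nonneg _) (hxi i) hr0.le).trans (le_of_eq ?_)
        rw [← Real.rpow_mul (norm_nonneg _), hc.symm.sub_one_mul_conj]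
    have hle : S ≤ ‖γ‖ * S ^ (1 - s⁻¹) := by
      calc S = ‖γ x‖ := by
            rw [hγ]
            simp_rw [hmul]
            rw [← RCLike.ofReal_sum, RCLike.norm_ofReal, abs_of_nonneg hS0]
        _ ≤ ‖γ‖ * ‖x‖ := γ.le_opNorm x
        _ ≤ _ := by gcongr
    rcases hS0.eq_or_lt with hS00 | hSpos
    · rw [← hS00, Real.zero_rpow (inv_pos.2 hs0).ne']
      exact norm_nonneg _
    · rw [Real.rpow_sub hSpos, Real.rpow_one, mul_div_assoc', le_div_iff₀ (by positivity),
        mul_comm ‖γ‖] at hle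
      exact le_of_mul_le_mul_left hle hSpos

end Duality

theorem isMultipleSumming_and_integral_eq {𝕜 : Type*} [RCLike 𝕜] (m N : ℕ) {p κ : ℝ} (hp : 0 < p)
    (hκ : 0 < κ) {r r' : ℝ≥0∞} [Fact (1 ≤ r)] (hrr' : ENNReal.HolderConjugate r r')
    (hr' : r' ≤ 2) (hpr : r'.toReal = 2 ∨ p < r'.toReal)
    (φ : ContinuousMultilinearMap 𝕜 (fun _ : Fin m => PiLp r (fun _ : Fin N => 𝕜)) 𝕜) :
    IsStableLaw 𝕜 r'.toReal κ (stableLaw 𝕜 r'.toReal κ) ∧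
    IsMultipleSumming p φ ∧
    Integrable
      (fun z : Fin m → Fin N → 𝕜 => ‖φ (fun i => WithLp.toLp r (z i))‖ ^ p)
      (Measure.pi fun _ : Fin m => stableMeasure 𝕜 r'.toReal κ N) ∧
    multipleSummingNorm p φ =
      1 / stableConst 𝕜 r'.toReal κ p ^ m *
        (∫ z : Fin m → Fin N → 𝕜, ‖φ (fun i => WithLp.toLp r (z i))‖ ^ p
          ∂(Measure.pi fun _ : Fin m => stableMeasure 𝕜 r'.toReal κ N)) ^ (1 / p) := by
  have hr't : r' ≠ ⊤ := (hr'.trans_lt (by simp)).ne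
  have hnorm := norm_dual_piLp (𝕜 := 𝕜) (N := N) hrr' hr't
  set s := r'.toReal with hs
  have hs0 : 0 < s := ENNReal.toReal_pos (ENNReal.HolderConjugate.ne_zero r' r) hr't
  have hs2 : s ≤ 2 := by simpa using ENNReal.toReal_mono (by simp) hr'
  have hlaw := isStableLaw_stableLaw 𝕜 hs0 hs2 hκ
  have hint := integrable_norm_rpow_stableLaw 𝕜 hs0 hs2 hκ hp hpr
  have hc := hlaw.integral_norm_rpow_pos hκ hp hint
  have := hlaw.1
  refine ⟨hlaw, ?_⟩
  have : IsProbabilityMeasure (stableMeasure 𝕜 s κ N) := by unfold stableMeasure; infer_instance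
  have hto : Continuous (WithLp.toLp r : (Fin N → 𝕜) → PiLp r fun _ : Fin N ↦ 𝕜) :=
    PiLp.continuous_toLp r _
  -- Transport to `PiLp` gives functionals their `ℓ_r`-dual norm, the one occurring in the weak
  -- norms.
  let μ := (stableMeasure 𝕜 s κ N).map (WithLp.toLp r : (Fin N → 𝕜) → PiLp r fun _ : Fin N ↦ 𝕜)
  have : IsProbabilityMeasure μ := Measure.isProbabilityMeasure_map hto.measurable.aemeasurable
  have hμ : ∀ γ : StrongDual 𝕜 (PiLp r fun _ : Fin N ↦ 𝕜), ∫⁻ z, ‖γ z‖ₑ ^ p ∂μ =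
      ENNReal.ofReal (∫ z, ‖z‖ ^ p ∂(stableLaw 𝕜 s κ)) * ‖γ‖ₑ ^ p := fun γ ↦ by
    rw [lintegral_map (by fun_prop) hto.measurable]
    rw [lintegral_congr fun z ↦ by rw [dual_piLp_apply γ z], lintegral_sum_stableMeasure hs0 hs2 hκ, ← hnorm,
      ofReal_integral_eq_lintegral_ofReal hint (ae_of_all _ fun z ↦ by positivity)]
    simp_rw [enorm_mul, ENNReal.mul_rpow_of_nonneg _ _ hp.le]
    rw [lintegral_const_mul _ (by fun_prop), mul_comm]
    simp_rw [enorm_rpow_eq_ofReal hp.le, RCLike.norm_ofReal, abs_norm]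
  have hmom : Integrable (fun z ↦ ‖z‖ ^ p) μ := by
    have hpow : Measurable fun z : PiLp r (fun _ : Fin N ↦ 𝕜) ↦ ‖z‖ ^ p :=
      measurable_norm.pow_const p
    rw [integrable_map_measure hpow.aestronglyMeasurable hto.measurable.aemeasurable]
    -- Comparing the `ℓ_r` norm with the sup norm reduces the moment to those of single coordinates.
    obtain ⟨K, hK0, hK⟩ :=
      (PiLp.continuousLinearEquiv r 𝕜 fun _ : Fin N ↦ 𝕜).symm.toContinuousLinearMap.bound
    have h1 : Integrable (fun z : Fin N → 𝕜 ↦ K ^ p * ∑ i, ‖z i‖ ^ p) (stableMeasure 𝕜 s κ N) := by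
      refine (integrable_finsetSum _ fun i _ ↦ ?_).const_mul _
      exact integrable_comp_eval (μ := fun _ : Fin N ↦ stableLaw 𝕜 s κ) (i := i) hint
    refine h1.mono' (hpow.comp hto.measurable).aestronglyMeasurable (ae_of_all _ fun z ↦ ?_)
    have hz : ‖z‖ ^ p ≤ ∑ i, ‖z i‖ ^ p := by
      rw [← Real.le_rpow_inv_iff_of_pos (norm_nonneg _) (by positivity) hp,
        pi_norm_le_iff_of_nonneg (by positivity)]
      intro i
      rw [Real.le_rpow_inv_iff_of_pos (norm_nonneg _) (by positivity) hp]
      exact Finset.single_le_sum (f := fun i ↦ ‖z i‖ ^ p) (fun i _ ↦ by positivity)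
        (Finset.mem_univ i)
    rw [Function.comp_apply, Real.norm_of_nonneg (by positivity)]
    calc ‖WithLp.toLp r z‖ ^ p ≤ (K * ‖z‖) ^ p :=
          Real.rpow_le_rpow (norm_nonneg _) (hK z) hp.le
      _ = K ^ p * ‖z‖ ^ p := Real.mul_rpow hK0.le (norm_nonneg _)
      _ ≤ _ := by gcongr
  obtain ⟨h1, h2, h3⟩ := multipleSummingNorm_eq_of_lintegral_dual hp hc hμ hmom φ
  have hpi : (Measure.pi fun _ : Fin m ↦ μ) =
      (Measure.pi fun _ : Fin m ↦ stableMeasure 𝕜 s κ N).map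
        fun z i ↦ (WithLp.toLp r (z i) : PiLp r fun _ : Fin N ↦ 𝕜) :=
    (Measure.pi_map_pi fun _ ↦ hto.measurable.aemeasurable).symm
  have hmeas : Measurable fun (z : Fin m → Fin N → 𝕜) i ↦
      (WithLp.toLp r (z i) : PiLp r fun _ : Fin N ↦ 𝕜) :=
    measurable_pi_lambda _ fun i ↦ hto.measurable.comp (measurable_pi_apply i)
  have hφ : Measurable fun z ↦ ‖φ z‖ ^ p := (φ.cont.measurable.norm).pow_const p
  refine ⟨h1, ?_, ?_⟩
  · rw [hpi, integrable_map_measure hφ.aestronglyMeasurable hmeas.aemeasurable] at h2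
    exact h2
  · rw [h3, hpi, integral_map hmeas.aemeasurable hφ.aestronglyMeasurable]
    rfl

end MultipleSumming

end

theorem theorem1p1 {𝕜 : Type*} [RCLike 𝕜] (m N : ℕ) (p κ : ℝ) (hp : 0 < p) (hκ : 0 < κ)
    (r r' : ℝ≥0∞) [Fact (1 ≤ r)] (hrr' : ENNReal.HolderConjugate r r')
    (hr : r = 2 ∨ (ENNReal.ofReal p < r' ∧ r' < 2))
    (φ : ContinuousMultilinearMap 𝕜 (fun _ : Fin m => PiLp r (fun _ : Fin N => 𝕜)) 𝕜) :
    MultipleSumming.IsStableLaw 𝕜 r'.toReal κ (MultipleSumming.stableLaw 𝕜 r'.toReal κ) ∧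
    MultipleSumming.IsMultipleSumming p φ ∧
    Integrable
      (fun z : Fin m → Fin N → 𝕜 => ‖φ (fun i => WithLp.toLp r (z i))‖ ^ p)
      (Measure.pi fun _ : Fin m => MultipleSumming.stableMeasure 𝕜 r'.toReal κ N) ∧
    MultipleSumming.multipleSummingNorm p φ =
      1 / MultipleSumming.stableConst 𝕜 r'.toReal κ p ^ m *
        (∫ z : Fin m → Fin N → 𝕜, ‖φ (fun i => WithLp.toLp r (z i))‖ ^ p
          ∂(Measure.pi fun _ : Fin m => MultipleSumming.stableMeasure 𝕜 r'.toReal κ N)) ^ (1 / p) := by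
  rcases hr with rfl | ⟨hpr, hr2⟩
  · have h2 : r' = 2 := ENNReal.HolderConjugate.unique 2 r' 2
    subst h2
    exact MultipleSumming.isMultipleSumming_and_integral_eq m N hp hκ hrr' le_rfl (Or.inl (by simp)) φ
  · refine MultipleSumming.isMultipleSumming_and_integral_eq m N hp hκ hrr' hr2.le (Or.inr ?_) φ
    exact (ENNReal.ofReal_lt_iff_lt_toReal hp.le (hr2.trans (by simp)).ne).1 hpr
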